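/- **Uniqueness and convergence in the multi-country, multi-sector trade model.** Let $J\ge 1$ be the number of countries and $S\ge 2$ the number of sectors. The primitives are labor endowments $L_i>0$, expenditure shares $\alpha_{is}>0$ with $\sum_s\alpha_{is}=1$, elasticities of substitution $\sigma_s>1$, trade elasticities $\theta_s>\sigma_s-1$, productivity levels $A_{is}>0$, and iceberg trade costs $\tau_{ijs}\in[1,\infty]$ from country $i$ to country $j$ with $\tau_{iis}<\infty$; put $\tau_{ijs}^{-\theta_s}=0$ if $\tau_{ijs}=\infty$. Call two countries $i,j$ trade partners if $\tau_{ijs}<\infty$ or $\tau_{jis}<\infty$ for some sector $s$, and assume that trade is connected (there are no separate trading blocks): any two countries are joined by a chain of trade partners. (This holds in particular if the directed graph on countries with an edge from $i$ to $j$ whenever $\tau_{ijs}<\infty$ for some $s$ is strongly connected.) Put $\Theta=\sum_s\theta_s$ and $g_s=\Gamma\!\left(\frac{\theta_s+1-\sigma_s}{\theta_s}\right)$, where $\Gamma$ is the Gamma function. Labor is the only input, so unit costs equal wages $w_i$. A general equilibrium consists of wages $w_i>0$, price indices $P_{is}>0$ and revenues $R_{is}>0$ such that for all $i,s$ $$P_{is}=g_s^{\frac1{1-\sigma_s}}\Big(\sum_jA_{js}(w_j\tau_{jis})^{-\theta_s}\Big)^{-1/\theta_s},\qquad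 R_{is}=\sum_j\frac{A_{is}(w_i\tau_{ijs})^{-\theta_s}}{\sum_kA_{ks}(w_k\tau_{kjs})^{-\theta_s}}\,\alpha_{js}w_jL_j,\qquad w_i=\frac1{L_i}\sum_sR_{is}.$$ Let $N=2JS+J$, write vectors $x\in\mathbb R^N$ as $x=\big((\Omega_{is}),(\mathbb P_{is}),(W_i)\big)$, and let $\mathbb R^N_{++}$ be the set of vectors with positive entries. Define $F$ on $\mathbb R^N_{++}$ by $$F(x)_{\Omega_{is}}=\sum_{j}g_s^{-\frac{\theta_s}{1-\sigma_s}}A_{is}\tau_{ijs}^{-\theta_s}\alpha_{js}L_j\,\mathbb P_{js}^{-1}W_j^{\frac1{1+\Theta}},\qquad F(x)_{\mathbb P_{is}}=\sum_{j}g_s^{-\frac{\theta_s}{1-\sigma_s}}A_{js}\tau_{jis}^{-\theta_s}W_j^{\frac{-\theta_s}{1+\Theta}},$$ $$F(x)_{W_i}=\sum_{r}L_i^{-1}\Omega_{ir}W_i^{\frac{\Theta-\theta_r}{1+\Theta}}.$$ Then: 1. For positive $w,P,R$, the triple $(w,P,R)$ is a general equilibrium if and only if $\Omega_{is}=R_{is}w_i^{\theta_s}$,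 $\mathbb P_{is}=P_{is}^{-\theta_s}$, $W_i=w_i^{1+\Theta}$ solve the fixed point equation $x=F(x)$. 2. $F$ maps $\mathbb R^N_{++}$ into itself and is continuously differentiable there. The entrywise modulus of its Jacobian matrix $|DF(x)|$ is irreducible for every $x\in\mathbb R^N_{++}$, and for every $x\in\mathbb R^N_{++}$ some diagonal entry of $DF(x)$ is non-zero. For every real $k\ne0$ let $u=u(k)$ be the vector with $u_{W_i}=k$, $u_{\mathbb P_{is}}=-\frac{\theta_s}{1+\Theta}k$, $u_{\Omega_{is}}=\frac{1+\theta_s}{1+\Theta}k$. Then $u\neq 0$, and with the notation $c^ux=(c^{u_v}x_v)_v$ one has $F(c^ux)=c^uF(x)$ for all $x\in\mathbb R^N_{++}$ and $c>0$. Moreover, the index set can be partitioned into $\zeta_+$ and $\zeta_-$ with $u_v\ge0$ on $\zeta_+$ and $u_v\le0$ on $\zeta_-$ such that, for all $x\in\mathbb R^N_{++}$, $\partial F_v(x)/\partial x_{v'}\ge0$ if $v,v'$ lie in the same one of the two sets and $\partial F_v(x)/\partial x_{v'}\le0$ otherwise. 3. Suppose that $x^*\in\mathbb R^N_{++}$ satisfies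 $F(x^*)=x^*$. Then for every $k\neq0$ the solutions of $x=F(x)$ in $\mathbb R^N_{++}$ are precisely the vectors $c^{u(k)}x^*$ with $c>0$. The solution $x^*$ (hence every solution) is Lyapunov stable: for every $\varepsilon>0$ there is $\delta>0$ such that $\|F^n(x)-F^n(x^*)\|<\varepsilon$ for all $n\ge0$ and all $x\in\mathbb R^N_{++}$ with $\|x-x^*\|<\delta$. For every $x\in\mathbb R^N_{++}$ the iterates $F^n(x)$ converge to a solution of $x=F(x)$ in $\mathbb R^N_{++}$ as $n\to\infty$. -/

import Mathlib

open Filter Topology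
open scoped ENNReal

noncomputable section

/-! ### Fixed point systems on the positive orthant -/

/-- The open positive orthant of `ℝ^V`. -/
def posOrthant (V : Type*) : Set (V → ℝ) := {x | ∀ v, 0 < x v}

/-- The Jacobian matrix of `F` at `x`: row `j`, column `k` holds `∂F_j(x)/∂x_k`. -/
def jacobian {V : Type*} [Fintype V] [DecidableEq V] (F : (V → ℝ) → (V → ℝ)) (x : V → ℝ) :
    Matrix V V ℝ :=
  Matrix.of fun j k => fderiv ℝ F x (Pi.single k 1) j

/-- `F` connects all variables: the entrywise modulus of the Jacobian matrix is irreducible at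
every positive point. -/
def ConnectsAllVariables {V : Type*} [Fintype V] [DecidableEq V]
    (F : (V → ℝ) → (V → ℝ)) : Prop :=
  ∀ x ∈ posOrthant V, ((jacobian F x).map fun a => |a|).IsIrreducible

/-- `F` exhibits self-interaction: at every positive point some diagonal entry of the Jacobian
matrix is non-zero. -/
def ExhibitsSelfInteraction {V : Type*} [Fintype V] [DecidableEq V]
    (F : (V → ℝ) → (V → ℝ)) : Prop :=
  ∀ x ∈ posOrthant V, ∃ j, jacobian F x j j ≠ 0

/-- The vector `c^u x = (c^{u_v} x_v)_v`. -/
def scaleBy {V : Type*} (c : ℝ) (u x : V → ℝ) : V → ℝ := fun v => c ^ u v * x v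

/-- `F` scales with exponent `u`. -/
def ScalesWithExponent {V : Type*} (F : (V → ℝ) → (V → ℝ)) (u : V → ℝ) : Prop :=
  ∀ x ∈ posOrthant V, ∀ c : ℝ, 0 < c → F (scaleBy c u x) = scaleBy c u (F x)

/-- The monotonicity behaviour of `F` is consistent with `u`. The partition of the index set
is `ζ₊ = ζ` and `ζ₋ = ζᶜ`. -/
def MonotonicityConsistentWith {V : Type*} [Fintype V] [DecidableEq V]
    (F : (V → ℝ) → (V → ℝ)) (u : V → ℝ) : Prop :=
  ∃ ζ : Set V, (∀ j ∈ ζ, 0 ≤ u j) ∧ (∀ j ∉ ζ, u j ≤ 0) ∧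
    ∀ x ∈ posOrthant V, ∀ j k,
      ((j ∈ ζ ↔ k ∈ ζ) → 0 ≤ jacobian F x j k) ∧
      (¬ (j ∈ ζ ↔ k ∈ ζ) → jacobian F x j k ≤ 0)

/-- `x` is a positive solution of the fixed point equation `x = F x`. -/
def IsPosFixedPoint {V : Type*} (F : (V → ℝ) → (V → ℝ)) (x : V → ℝ) : Prop :=
  x ∈ posOrthant V ∧ F x = x

/-- Lyapunov stability of `xs` for the discrete dynamical system `x ↦ F x` on the positive
orthant. The metric is the maximum metric; the notion does not depend on the norm. -/
def IsLyapunovStable {V : Type*} [Fintype V] (F : (V → ℝ) → (V → ℝ)) (xs : V → ℝ) : Prop :=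
  ∀ ε > 0, ∃ δ > 0, ∀ x ∈ posOrthant V, dist x xs < δ →
    ∀ n : ℕ, dist (F^[n] x) (F^[n] xs) < ε

/-! ### The multi-country, multi-sector trade model with labor as the only input -/

/-- Primitives of the model with `J` countries and `S` sectors. -/
structure TradeModel (J S : ℕ) where
  /-- labor endowments -/
  L : Fin J → ℝ
  /-- Cobb-Douglas expenditure shares of country `i` on sector `s` -/
  α : Fin J → Fin S → ℝ
  /-- elasticities of substitution between varieties -/
  σ : Fin S → ℝ
  /-- sector-specific trade elasticities (Fréchet shape parameters) -/
  θ : Fin S → ℝ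
  /-- average productivities (Fréchet location parameters) -/
  A : Fin J → Fin S → ℝ
  /-- iceberg trade costs `τ i j s` from exporter `i` to importer `j`; `⊤` means no trade -/
  τ : Fin J → Fin J → Fin S → ℝ≥0∞
  L_pos : ∀ i, 0 < L i
  α_pos : ∀ i s, 0 < α i s
  α_sum : ∀ i, ∑ s, α i s = 1
  one_lt_σ : ∀ s, 1 < σ s
  σ_sub_one_lt_θ : ∀ s, σ s - 1 < θ s
  A_pos : ∀ i s, 0 < A i s
  one_le_τ : ∀ i j s, 1 ≤ τ i j s
  τ_self : ∀ i s, τ i i s ≠ ⊤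

namespace TradeModel

variable {J S : ℕ} (M : TradeModel J S)

/-- Two countries are trade partners if at least one of them can ship to the other at finite
cost in some sector. -/
def TradePartners (i j : Fin J) : Prop := ∃ s, M.τ i j s ≠ ⊤ ∨ M.τ j i s ≠ ⊤

/-- The trade network has no completely separate trading blocks: every country is reachable from
every other one through a chain of trade partners. -/
def TradeConnected : Prop := ∀ i j, Relation.ReflTransGen M.TradePartners i j

/-- `τ_{ijs}^{-θ_s}`, which is `0` when `τ_{ijs} = ∞`. -/
def freeness (i j : Fin J) (s : Fin S) : ℝ := (M.τ i j s ^ (-M.θ s)).toReal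

/-- `Θ = ∑ s, θ_s`. -/
def Θ : ℝ := ∑ s, M.θ s

/-- The Gamma function value `Γ((θ_s + 1 - σ_s) / θ_s)`. -/
def gammaVal (s : Fin S) : ℝ := Real.Gamma ((M.θ s + 1 - M.σ s) / M.θ s)

/-- Share of country `j`'s expenditure on sector `s` that falls on varieties from country `i`,
at wages `w` (unit costs equal wages). -/
def importShare (w : Fin J → ℝ) (i j : Fin J) (s : Fin S) : ℝ :=
  M.A i s * (w i ^ (-M.θ s) * M.freeness i j s) /
    ∑ k, M.A k s * (w k ^ (-M.θ s) * M.freeness k j s)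

/-- General equilibrium in wages `w`, price indices `P` and sectoral revenues `R`. -/
structure IsGeneralEquilibrium (w : Fin J → ℝ) (P R : Fin J → Fin S → ℝ) : Prop where
  w_pos : ∀ i, 0 < w i
  P_pos : ∀ i s, 0 < P i s
  R_pos : ∀ i s, 0 < R i s
  price_index : ∀ i s, P i s = M.gammaVal s ^ (1 / (1 - M.σ s)) *
    (∑ j, M.A j s * (w j ^ (-M.θ s) * M.freeness j i s)) ^ (-1 / M.θ s)
  /-- goods market clearing, with country `j` spending `α_{js} w_j L_j` on sector `s` -/
  goods_market : ∀ i s, R i s = ∑ j, M.importShare w i j s * (M.α j s * w j * M.L j)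
  labor_market : ∀ i, w i = (∑ s, R i s) / M.L i

/-- Index set of the stacked vector of equilibrium variables: `Ω_{is}`, then `ℙ_{is}`, then
`W_i`. -/
abbrev Var (J S : ℕ) : Type := (Fin J × Fin S) ⊕ (Fin J × Fin S) ⊕ Fin J

/-- The index of `Ω_{is}`. -/
abbrev iΩ (i : Fin J) (s : Fin S) : Var J S := Sum.inl (i, s)

/-- The index of `ℙ_{is}`. -/
abbrev iP (i : Fin J) (s : Fin S) : Var J S := Sum.inr (Sum.inl (i, s))

/-- The index of `W_i`. -/
abbrev iW (i : Fin J) : Var J S := Sum.inr (Sum.inr i)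

/-- The stacked vector with the given blocks. -/
def stack (Om Pr : Fin J → Fin S → ℝ) (W : Fin J → ℝ) : Var J S → ℝ :=
  Sum.elim (fun p => Om p.1 p.2) (Sum.elim (fun p => Pr p.1 p.2) W)

/-- The right-hand side of the equilibrium system in `(Ω, ℙ, W)`. -/
def rhs (x : Var J S → ℝ) : Var J S → ℝ :=
  stack
    (fun i s => ∑ j, M.gammaVal s ^ (-(M.θ s / (1 - M.σ s))) * M.A i s * M.freeness i j s *
      M.α j s * M.L j * (x (iP j s))⁻¹ * x (iW j) ^ (1 / (1 + M.Θ)))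
    (fun i s => ∑ j, M.gammaVal s ^ (-(M.θ s / (1 - M.σ s))) * M.A j s * M.freeness j i s *
      x (iW j) ^ (-M.θ s / (1 + M.Θ)))
    (fun i => ∑ r, (M.L i)⁻¹ * x (iΩ i r) * x (iW i) ^ ((M.Θ - M.θ r) / (1 + M.Θ)))

/-- The equilibrium variables `Ω_{is} = R_{is} w_i^{θ_s}`, `ℙ_{is} = P_{is}^{-θ_s}` and
`W_i = w_i^{1+Θ}` that belong to wages, price indices and revenues. -/
def toVariables (w : Fin J → ℝ) (P R : Fin J → Fin S → ℝ) : Var J S → ℝ :=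
  stack (fun i s => R i s * w i ^ M.θ s) (fun i s => P i s ^ (-M.θ s)) (fun i => w i ^ (1 + M.Θ))

/-- The exponent `u` with `u_Ω = (1+θ_s)k/(1+Θ)`, `u_ℙ = -θ_s k/(1+Θ)` and `u_W = k`. -/
def scalingExponent (k : ℝ) : Var J S → ℝ :=
  stack (fun _ s => (1 + M.θ s) / (1 + M.Θ) * k) (fun _ s => -(M.θ s / (1 + M.Θ)) * k)
    (fun _ => k)

end TradeModel

end

/-! ### Monotone, additively homogeneous maps -/

namespace AdditivelyHomogeneous

variable {V : Type*} {T : (V → ℝ) → (V → ℝ)}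

/-! Write `x_v = exp (u_v t_v)` with `u = u(1)`, which vanishes nowhere. In the coordinates `t` the
system becomes a map `T = logRhs`. Scaling of `F` with exponent `u` turns into `T (t + c) = T t +
c`. The signs of `u` match the sign pattern of the Jacobian, so `T` is monotone (`monotone_logRhs`).

A monotone map that commutes with adding constants is nonexpansive for the maximum metric; this
gives Lyapunov stability. The dependence graph of the variables is strongly connected
(`reflTransGen_dependsOn`) and has a loop, so for any two comparable distinct points some iterate
separates them strictly in every entry (`exists_iterate_lt`).

Let `ts` be a fixed point. The largest entry of `T^n t - ts` decreases to some `c`, and it equals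
`c` along the whole orbit of each cluster point `p`. Hence `p ≤ ts + c`, and strict separation
excludes `p ≠ ts + c`. The bounded orbit has only one cluster point and converges
(`exists_tendsto_iterate`). Uniqueness up to scale follows by applying convergence to the constant
orbit of a second fixed point.

The link to equilibria is a change of variables by powers: each fixed point equation is an
equilibrium condition raised to a power or multiplied by a power of the wage. -/

theorem iterate_add_const (hadd : ∀ t c, T (fun v => t v + c) = fun v => T t v + c)
    (n : ℕ) (t : V → ℝ) (c : ℝ) :
    T^[n] (fun v => t v + c) = fun v => T^[n] t v + c := by
  induction n generalizing t with
  | zero => rfl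
  | succ n ih => rw [Function.iterate_succ_apply, hadd, ih, Function.iterate_succ_apply]

/-- Apply `T` to `t ≤ t' + dist t t'`, pull the constant out, and exchange the roles of `t` and
`t'`. -/
theorem lipschitzWith_one [Fintype V] (hmono : Monotone T)
    (hadd : ∀ t c, T (fun v => t v + c) = fun v => T t v + c) : LipschitzWith 1 T := by
  refine LipschitzWith.of_dist_le_mul fun t t' => ?_
  have key : ∀ a b : V → ℝ, ∀ v, T a v - T b v ≤ dist a b := fun a b v => by
    have h : a ≤ fun v => b v + dist a b := fun w => by
      have := (le_abs_self _).trans (dist_le_pi_dist a b w)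
      linarith
    have := hmono h v
    rw [hadd] at this
    linarith
  rw [NNReal.coe_one, one_mul, dist_pi_le_iff dist_nonneg]
  intro v
  rw [Real.dist_eq, abs_sub_le_iff]
  exact ⟨key t t' v, dist_comm t t' ▸ key t' t v⟩

theorem lipschitzWith_one_iterate [Fintype V] (hmono : Monotone T)
    (hadd : ∀ t c, T (fun v => t v + c) = fun v => T t v + c) (n : ℕ) :
    LipschitzWith 1 T^[n] := by
  simpa using (lipschitzWith_one hmono hadd).iterate n

/-- If every variable depends strictly on the variables it is related to, and this relation is
strongly connected with a loop, then some iterate is strictly monotone in every entry. -/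
theorem exists_iterate_lt [Finite V] (hmono : Monotone T) {E : V → V → Prop}
    (hstrict : ∀ t t' v v', t ≤ t' → E v v' → t v' < t' v' → T t v < T t' v)
    (hconn : ∀ v v', Relation.ReflTransGen E v v') {a : V} (ha : E a a)
    {t t' : V → ℝ} (hle : t ≤ t') (hne : t ≠ t') :
    ∃ N, ∀ v, T^[N] t v < T^[N] t' v := by
  have hle' : ∀ n, T^[n] t ≤ T^[n] t' := fun n => hmono.iterate n hle
  have step : ∀ n v v', E v v' → T^[n] t v' < T^[n] t' v' → T^[n + 1] t v < T^[n + 1] t' v := by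
    intro n v v' hE h
    rw [Function.iterate_succ_apply', Function.iterate_succ_apply']
    exact hstrict _ _ _ _ (hle' n) hE h
  have walk : ∀ v v', ∃ k, ∀ n, T^[n] t v' < T^[n] t' v' →
      T^[n + k] t v < T^[n + k] t' v := by
    intro v v'
    induction hconn v v' using Relation.ReflTransGen.head_induction_on with
    | refl => exact ⟨0, fun n h => h⟩
    | head hE _ ih =>
      obtain ⟨k, hk⟩ := ih
      exact ⟨k + 1, fun n h => step _ _ _ hE (hk n h)⟩
  obtain ⟨b, hb⟩ : ∃ b, t b < t' b := by
    by_contra! h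
    exact hne (le_antisymm hle h)
  obtain ⟨m, hm⟩ := walk a b
  -- The loop at `a` preserves strictness there at all later times, so walks of different lengths
  -- from `a` can be timed to end at a common iterate.
  have haux : ∀ n, T^[m + n] t a < T^[m + n] t' a := by
    intro n
    induction n with
    | zero => simpa using hm 0 hb
    | succ n ih => exact step _ _ _ ha ih
  have hev : ∀ v, ∀ᶠ N in atTop, T^[N] t v < T^[N] t' v := by
    intro v
    obtain ⟨k, hk⟩ := walk v a
    filter_upwards [eventually_ge_atTop (m + k)] with N hN
    obtain ⟨n, rfl⟩ := Nat.exists_eq_add_of_le hN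
    rw [show m + k + n = m + n + k by ring]
    exact hk _ (haux n)
  exact (eventually_all.2 hev).exists

/-- Global convergence of a monotone, additively homogeneous map with a fixed point and eventually
strictly monotone iterates. -/
theorem exists_tendsto_iterate [Fintype V] [Nonempty V] (hmono : Monotone T)
    (hadd : ∀ t c, T (fun v => t v + c) = fun v => T t v + c)
    (hlt : ∀ t t' : V → ℝ, t ≤ t' → t ≠ t' → ∃ N, ∀ v, T^[N] t v < T^[N] t' v)
    {ts : V → ℝ} (hts : T ts = ts) (t : V → ℝ) :
    ∃ c, Tendsto (fun n => T^[n] t) atTop (𝓝 fun v => ts v + c) := by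
  have hfix : ∀ n c, T^[n] (fun v => ts v + c) = fun v => ts v + c := fun n c => by
    rw [iterate_add_const hadd, Function.iterate_fixed hts]
  have hdist : ∀ n, dist (T^[n] t) ts ≤ dist t ts := fun n => by
    simpa [Function.iterate_fixed hts] using
      (lipschitzWith_one_iterate hmono hadd n).dist_le_mul t ts
  -- The least `c` with `p ≤ ts + c`; it cannot increase under `T`, because `ts + c` is fixed.
  let g : (V → ℝ) → ℝ := fun p => Finset.univ.sup' Finset.univ_nonempty fun v => p v - ts v
  have hg : Continuous g := by
    refine Continuous.finset_sup'_apply _ fun v _ => ?_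
    fun_prop
  have hg_le : ∀ p c, g p ≤ c ↔ p ≤ fun v => ts v + c := fun p c => by
    simp [g, Pi.le_def, add_comm]
  have hg_lt : ∀ p c, g p < c ↔ ∀ v, p v < ts v + c := fun p c => by
    simp [g, sub_lt_iff_lt_add, add_comm]
  have hg_T : ∀ p, g (T p) ≤ g p := fun p => by
    rw [hg_le]
    simpa [hadd, hts] using hmono ((hg_le p _).1 le_rfl)
  have hanti : Antitone fun n => g (T^[n] t) := antitone_nat_of_succ_le fun n => by
    rw [Function.iterate_succ_apply']
    exact hg_T _
  have hbdd : BddBelow (Set.range fun n => g (T^[n] t)) := by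
    refine ⟨-dist t ts, ?_⟩
    rintro _ ⟨n, rfl⟩
    obtain ⟨v⟩ := ‹Nonempty V›
    have h1 : T^[n] t v - ts v ≤ g (T^[n] t) :=
      Finset.le_sup' (fun v => T^[n] t v - ts v) (Finset.mem_univ v)
    have h2 := (neg_abs_le _).trans' (neg_le_neg ((dist_le_pi_dist (T^[n] t) ts v).trans (hdist n)))
    exact h2.trans h1
  set c := ⨅ n, g (T^[n] t) with hc
  have hlim : Tendsto (fun n => g (T^[n] t)) atTop (𝓝 c) := tendsto_atTop_ciInf hanti hbdd
  refine ⟨c, (isCompact_closedBall ts (dist t ts)).tendsto_nhds_of_unique_mapClusterPt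
    (Eventually.of_forall hdist) fun p _ hp => ?_⟩
  -- By continuity `g (T^[N] p)` is a cluster point of `g (T^[n + N] t)`, a sequence that converges
  -- to `c`.
  have hval : ∀ N, g (T^[N] p) = c := by
    intro N
    have h1 := hp.continuousAt_comp
      (hg.comp (lipschitzWith_one_iterate hmono hadd N).continuous).continuousAt
    have h2 : Tendsto ((g ∘ T^[N]) ∘ fun n => T^[n] t) atTop (𝓝 c) := by
      refine (hlim.comp (tendsto_add_atTop_nat N)).congr fun n => ?_
      simp only [Function.comp_apply]
      rw [add_comm, Function.iterate_add_apply]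
    by_contra hne
    exact (show NeBot _ from h1).ne ((disjoint_nhds_nhds.2 hne).mono_right h2).eq_bot
  by_contra hne
  obtain ⟨N, hN⟩ := hlt p _ ((hg_le p c).1 (hval 0).le) hne
  rw [hfix] at hN
  exact ((hg_lt _ _).2 hN).ne (hval N)

end AdditivelyHomogeneous

namespace TradeModel

variable {J S : ℕ} (M : TradeModel J S)

/-! ### Positivity -/

theorem θ_pos (s : Fin S) : 0 < M.θ s := by
  linarith [M.one_lt_σ s, M.σ_sub_one_lt_θ s]

theorem Θ_nonneg : 0 ≤ M.Θ := Finset.sum_nonneg fun s _ => (M.θ_pos s).le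

theorem one_add_Θ_pos : 0 < 1 + M.Θ := by linarith [M.Θ_nonneg]

/-- A second sector contributes a positive term to `Θ`. The strict inequality makes the exponent of
`W_i` in the wage equation positive, which yields both monotonicity and the loop at `W_i`. -/
theorem θ_lt_Θ (hS : 2 ≤ S) (s : Fin S) : M.θ s < M.Θ := by
  have : Nontrivial (Fin S) := Fin.nontrivial_iff_two_le.2 hS
  obtain ⟨r, hr⟩ := exists_ne s
  exact Finset.single_lt_sum hr (Finset.mem_univ s) (Finset.mem_univ r) (M.θ_pos r)
    fun k _ _ => (M.θ_pos k).le

theorem gammaVal_pos (s : Fin S) : 0 < M.gammaVal s :=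
  Real.Gamma_pos_of_pos (div_pos (by linarith [M.σ_sub_one_lt_θ s]) (M.θ_pos s))

theorem freeness_nonneg (i j : Fin J) (s : Fin S) : 0 ≤ M.freeness i j s :=
  ENNReal.toReal_nonneg

theorem freeness_pos {i j : Fin J} {s : Fin S} (h : M.τ i j s ≠ ⊤) : 0 < M.freeness i j s := by
  have h0 : M.τ i j s ≠ 0 := (zero_lt_one.trans_le (M.one_le_τ i j s)).ne'
  exact ENNReal.toReal_pos (ENNReal.rpow_pos (pos_iff_ne_zero.2 h0) h).ne'
    (by simp [ENNReal.rpow_eq_top_iff, h0, h])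

/-- The constant factor `g_s^{-θ_s/(1-σ_s)} A_{is} τ_{ijs}^{-θ_s}`. -/
noncomputable def coeff (i j : Fin J) (s : Fin S) : ℝ :=
  M.gammaVal s ^ (-(M.θ s / (1 - M.σ s))) * M.A i s * M.freeness i j s

theorem coeff_nonneg (i j : Fin J) (s : Fin S) : 0 ≤ M.coeff i j s :=
  mul_nonneg (mul_pos (Real.rpow_pos_of_pos (M.gammaVal_pos s) _) (M.A_pos i s)).le
    (M.freeness_nonneg i j s)

theorem coeff_pos {i j : Fin J} {s : Fin S} (h : M.τ i j s ≠ ⊤) : 0 < M.coeff i j s :=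
  mul_pos (mul_pos (Real.rpow_pos_of_pos (M.gammaVal_pos s) _) (M.A_pos i s)) (M.freeness_pos h)

/-- The constant factor `g_s^{-θ_s/(1-σ_s)} A_{is} τ_{ijs}^{-θ_s} α_{js} L_j`. -/
noncomputable def demandCoeff (i j : Fin J) (s : Fin S) : ℝ := M.coeff i j s * (M.α j s * M.L j)

theorem demandCoeff_nonneg (i j : Fin J) (s : Fin S) : 0 ≤ M.demandCoeff i j s :=
  mul_nonneg (M.coeff_nonneg i j s) (mul_pos (M.α_pos j s) (M.L_pos j)).le

theorem demandCoeff_pos {i j : Fin J} {s : Fin S} (h : M.τ i j s ≠ ⊤) :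
    0 < M.demandCoeff i j s :=
  mul_pos (M.coeff_pos h) (mul_pos (M.α_pos j s) (M.L_pos j))

theorem rhs_iΩ (x : Var J S → ℝ) (i : Fin J) (s : Fin S) :
    M.rhs x (iΩ i s) =
      ∑ j, M.demandCoeff i j s * ((x (iP j s))⁻¹ * x (iW j) ^ (1 / (1 + M.Θ))) := by
  simp only [rhs, stack, Sum.elim_inl, demandCoeff, coeff]
  exact Finset.sum_congr rfl fun j _ => by ring

theorem rhs_iP (x : Var J S → ℝ) (i : Fin J) (s : Fin S) :
    M.rhs x (iP i s) = ∑ j, M.coeff j i s * x (iW j) ^ (-M.θ s / (1 + M.Θ)) := rfl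

theorem rhs_iW (x : Var J S → ℝ) (i : Fin J) :
    M.rhs x (iW i) =
      ∑ r, (M.L i)⁻¹ * (x (iΩ i r) * x (iW i) ^ ((M.Θ - M.θ r) / (1 + M.Θ))) := by
  simp only [rhs, stack, Sum.elim_inr]
  exact Finset.sum_congr rfl fun r _ => by ring

theorem mapsTo_rhs (hS : 0 < S) :
    Set.MapsTo M.rhs (posOrthant (Var J S)) (posOrthant (Var J S)) := by
  have : NeZero S := ⟨hS.ne'⟩
  intro x hx v
  have hpow : ∀ v (a : ℝ), 0 < x v ^ a := fun v a => Real.rpow_pos_of_pos (hx v) a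
  rcases v with ⟨i, s⟩ | ⟨i, s⟩ | i
  · rw [rhs_iΩ]
    exact Finset.sum_pos' (fun j _ => mul_nonneg (M.demandCoeff_nonneg i j s)
        (mul_pos (inv_pos.2 (hx _)) (hpow _ _)).le)
      ⟨i, Finset.mem_univ i, mul_pos (M.demandCoeff_pos (M.τ_self i s))
        (mul_pos (inv_pos.2 (hx _)) (hpow _ _))⟩
  · rw [rhs_iP]
    exact Finset.sum_pos' (fun j _ => mul_nonneg (M.coeff_nonneg j i s) (hpow _ _).le)
      ⟨i, Finset.mem_univ i, mul_pos (M.coeff_pos (M.τ_self i s)) (hpow _ _)⟩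
  · rw [rhs_iW]
    exact Finset.sum_pos (fun r _ => mul_pos (inv_pos.2 (M.L_pos i))
      (mul_pos (hx _) (hpow _ _))) Finset.univ_nonempty

/-! ### Equilibria and fixed points -/

theorem rpow_one_add_Θ_rpow {w : ℝ} (hw : 0 < w) (a : ℝ) :
    (w ^ (1 + M.Θ)) ^ (a / (1 + M.Θ)) = w ^ a := by
  rw [← Real.rpow_mul hw.le, mul_div_cancel₀ _ M.one_add_Θ_pos.ne']

theorem sum_supply_pos {w : Fin J → ℝ} (hw : ∀ i, 0 < w i) (j : Fin J) (s : Fin S) :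
    0 < ∑ k, M.A k s * (w k ^ (-M.θ s) * M.freeness k j s) :=
  Finset.sum_pos' (fun k _ => mul_nonneg (M.A_pos k s).le
      (mul_nonneg (Real.rpow_pos_of_pos (hw k) _).le (M.freeness_nonneg k j s)))
    ⟨j, Finset.mem_univ j, mul_pos (M.A_pos j s)
      (mul_pos (Real.rpow_pos_of_pos (hw j) _) (M.freeness_pos (M.τ_self j s)))⟩

/-- The power `-θ_s` is injective on positive numbers. -/
theorem price_index_iff {P D : ℝ} (hP : 0 < P) (hD : 0 < D) (s : Fin S) :
    P = M.gammaVal s ^ (1 / (1 - M.σ s)) * D ^ (-1 / M.θ s) ↔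
      M.gammaVal s ^ (-(M.θ s / (1 - M.σ s))) * D = P ^ (-M.θ s) := by
  have hg := M.gammaVal_pos s
  have hθ := (M.θ_pos s).ne'
  have key : (M.gammaVal s ^ (1 / (1 - M.σ s)) * D ^ (-1 / M.θ s)) ^ (-M.θ s) =
      M.gammaVal s ^ (-(M.θ s / (1 - M.σ s))) * D := by
    rw [Real.mul_rpow (Real.rpow_pos_of_pos hg _).le (Real.rpow_pos_of_pos hD _).le,
      ← Real.rpow_mul hg.le, ← Real.rpow_mul hD.le,
      show -1 / M.θ s * -M.θ s = 1 by field_simp, Real.rpow_one]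
    congr 2
    ring
  rw [← key]
  constructor
  · exact fun h => by rw [← h]
  · intro h
    exact ((Real.rpow_left_inj (mul_pos (Real.rpow_pos_of_pos hg _)
      (Real.rpow_pos_of_pos hD _)).le hP.le (neg_ne_zero.2 hθ)).1 h).symm

/-- The wage equation is labor market clearing times `w_i ^ Θ`. The `Ω` equation is goods market
clearing times `w_i ^ θ_s`, but only once the price equations identify `ℙ_{js}` with a multiple of
the denominator of the import share; hence `goods` assumes them. -/
theorem isGeneralEquilibrium_iff {w : Fin J → ℝ} {P R : Fin J → Fin S → ℝ} (hw : ∀ i, 0 < w i)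
    (hP : ∀ i s, 0 < P i s) (hR : ∀ i s, 0 < R i s) :
    M.IsGeneralEquilibrium w P R ↔ M.rhs (M.toVariables w P R) = M.toVariables w P R := by
  have hΩ (i s) : M.toVariables w P R (iΩ i s) = R i s * w i ^ M.θ s := rfl
  have hPr (i s) : M.toVariables w P R (iP i s) = P i s ^ (-M.θ s) := rfl
  have hW (i) : M.toVariables w P R (iW i) = w i ^ (1 + M.Θ) := rfl
  have price (i s) : P i s = M.gammaVal s ^ (1 / (1 - M.σ s)) *
        (∑ j, M.A j s * (w j ^ (-M.θ s) * M.freeness j i s)) ^ (-1 / M.θ s) ↔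
      M.rhs (M.toVariables w P R) (iP i s) = M.toVariables w P R (iP i s) := by
    rw [M.price_index_iff (hP i s) (M.sum_supply_pos hw i s) s, rhs_iP, hPr, Finset.mul_sum]
    simp only [hW, M.rpow_one_add_Θ_rpow (hw _), coeff]
    refine Eq.congr_left (Finset.sum_congr rfl fun j _ => by ring)
  have goods (hpr : ∀ i s, M.rhs (M.toVariables w P R) (iP i s) = M.toVariables w P R (iP i s))
      (i s) : R i s = ∑ j, M.importShare w i j s * (M.α j s * w j * M.L j) ↔
      M.rhs (M.toVariables w P R) (iΩ i s) = M.toVariables w P R (iΩ i s) := by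
    have hwθ := Real.rpow_pos_of_pos (hw i) (M.θ s)
    have hsum : M.rhs (M.toVariables w P R) (iΩ i s) =
        (∑ j, M.importShare w i j s * (M.α j s * w j * M.L j)) * w i ^ M.θ s := by
      rw [rhs_iΩ, Finset.sum_mul]
      refine Finset.sum_congr rfl fun j _ => ?_
      have hD := M.sum_supply_pos hw j s
      have hg := Real.rpow_pos_of_pos (M.gammaVal_pos s) (-(M.θ s / (1 - M.σ s)))
      have hPj := (M.price_index_iff (hP j s) hD s).1 ((price j s).2 (hpr j s))
      rw [hPr, ← hPj, hW, M.rpow_one_add_Θ_rpow (hw j), Real.rpow_one, demandCoeff, coeff,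
        importShare, Real.rpow_neg (hw i).le]
      set D := ∑ k, M.A k s * (w k ^ (-M.θ s) * M.freeness k j s)
      field_simp
    rw [hsum, hΩ, mul_left_inj' hwθ.ne', eq_comm]
  have labor (i) : w i = (∑ s, R i s) / M.L i ↔
      M.rhs (M.toVariables w P R) (iW i) = M.toVariables w P R (iW i) := by
    have hwΘ := Real.rpow_pos_of_pos (hw i) M.Θ
    have hsum : M.rhs (M.toVariables w P R) (iW i) = (∑ s, R i s) / M.L i * w i ^ M.Θ := by
      rw [rhs_iW, Finset.sum_div, Finset.sum_mul]
      refine Finset.sum_congr rfl fun r _ => ?_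
      rw [hΩ, hW, M.rpow_one_add_Θ_rpow (hw i), Real.rpow_sub (hw i)]
      have := Real.rpow_pos_of_pos (hw i) (M.θ r)
      field_simp
    rw [hsum, hW, Real.rpow_add (hw i), Real.rpow_one, mul_left_inj' hwΘ.ne', eq_comm]
  constructor
  · intro h
    have hpr i s := (price i s).1 (h.price_index i s)
    funext v
    rcases v with ⟨i, s⟩ | ⟨i, s⟩ | i
    · exact (goods hpr i s).1 (h.goods_market i s)
    · exact hpr i s
    · exact (labor i).1 (h.labor_market i)
  · intro h
    have h' v := congrFun h v
    exact ⟨hw, hP, hR, fun i s => (price i s).2 (h' _),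
      fun i s => (goods (fun i s => h' _) i s).2 (h' _), fun i => (labor i).2 (h' _)⟩

/-! ### Scaling -/

theorem scalingExponent_iΩ (k : ℝ) (i : Fin J) (s : Fin S) :
    M.scalingExponent k (iΩ i s) = (1 + M.θ s) / (1 + M.Θ) * k := rfl

theorem scalingExponent_iP (k : ℝ) (i : Fin J) (s : Fin S) :
    M.scalingExponent k (iP i s) = -(M.θ s / (1 + M.Θ)) * k := rfl

theorem scalingExponent_iW (k : ℝ) (i : Fin J) :
    M.scalingExponent (S := S) k (iW i) = k := rfl

theorem scalingExponent_ne_zero {k : ℝ} (hk : k ≠ 0) (v : Var J S) :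
    M.scalingExponent k v ≠ 0 := by
  have hΘ := M.one_add_Θ_pos
  rcases v with ⟨i, s⟩ | ⟨i, s⟩ | i
  · have := M.θ_pos s
    exact mul_ne_zero (by positivity) hk
  · have := M.θ_pos s
    exact mul_ne_zero (neg_ne_zero.2 (by positivity)) hk
  · exact hk

/-- Linearity in `k` reduces sign and uniqueness questions to `k = 1`. -/
theorem scalingExponent_eq_mul (k : ℝ) (v : Var J S) :
    M.scalingExponent k v = M.scalingExponent 1 v * k := by
  rcases v with ⟨i, s⟩ | ⟨i, s⟩ | i
  · simp [scalingExponent_iΩ]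
  · simp [scalingExponent_iP]
  · simp [scalingExponent_iW]

theorem scalesWithExponent_rhs (k : ℝ) :
    ScalesWithExponent M.rhs (M.scalingExponent k) := by
  intro x hx c hc
  have hΘ := M.one_add_Θ_pos.ne'
  have hpow (u y a : ℝ) (hy : 0 < y) : (c ^ u * y) ^ a = c ^ (u * a) * y ^ a := by
    rw [Real.mul_rpow (Real.rpow_pos_of_pos hc _).le hy.le, Real.rpow_mul hc.le]
  funext v
  rcases v with ⟨i, s⟩ | ⟨i, s⟩ | i
  · change _ = c ^ _ * M.rhs x (iΩ i s)
    change M.rhs _ (iΩ i s) = _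
    rw [rhs_iΩ, rhs_iΩ, Finset.mul_sum]
    refine Finset.sum_congr rfl fun j _ => ?_
    simp only [scaleBy, hpow _ _ _ (hx _), mul_inv, ← Real.rpow_neg hc.le]
    rw [show M.scalingExponent k (Sum.inl (i, s)) =
      -M.scalingExponent k (iP j s) + M.scalingExponent k (iW j : Var J S) * (1 / (1 + M.Θ)) by
        rw [scalingExponent_iΩ, scalingExponent_iP, scalingExponent_iW]; field_simp; ring,
      Real.rpow_add hc]
    ring
  · change M.rhs _ (iP i s) = c ^ _ * M.rhs x (iP i s)
    rw [rhs_iP, rhs_iP, Finset.mul_sum]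
    refine Finset.sum_congr rfl fun j _ => ?_
    simp only [scaleBy, hpow _ _ _ (hx _)]
    rw [show M.scalingExponent k (Sum.inr (Sum.inl (i, s))) =
      M.scalingExponent k (iW j : Var J S) * (-M.θ s / (1 + M.Θ)) by
        rw [scalingExponent_iP, scalingExponent_iW]; ring]
    ring
  · change M.rhs _ (iW i) = c ^ _ * M.rhs x (iW i)
    rw [rhs_iW, rhs_iW, Finset.mul_sum]
    refine Finset.sum_congr rfl fun r _ => ?_
    simp only [scaleBy, hpow _ _ _ (hx _)]
    have hu : c ^ M.scalingExponent k (Sum.inr (Sum.inr i) : Var J S) =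
        c ^ M.scalingExponent k (iΩ i r) *
          c ^ (M.scalingExponent k (iW i : Var J S) * ((M.Θ - M.θ r) / (1 + M.Θ))) := by
      rw [← Real.rpow_add hc, scalingExponent_iΩ, scalingExponent_iW]
      congr 1
      field_simp
      ring
    rw [hu]
    ring

/-! ### Dependence between the variables -/

/-- `M.DependsOn v v'` if the `v`-th entry of the system depends on the variable `v'`. -/
inductive DependsOn : Var J S → Var J S → Prop
  | iΩ_iP {i j : Fin J} {s : Fin S} (h : M.τ i j s ≠ ⊤) : DependsOn (iΩ i s) (iP j s)
  | iΩ_iW {i j : Fin J} {s : Fin S} (h : M.τ i j s ≠ ⊤) : DependsOn (iΩ i s) (iW j)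
  | iP_iW {i j : Fin J} {s : Fin S} (h : M.τ j i s ≠ ⊤) : DependsOn (iP i s) (iW j)
  | iW_iΩ (i : Fin J) (r : Fin S) : DependsOn (iW i) (iΩ i r)
  | iW_iW (i : Fin J) : DependsOn (iW i) (iW i)

/-- Partnership is symmetric while dependence is directed. If `i` ships to `j`, then `W_i` reaches
`W_j` through `Ω_{is}`. If `j` ships to `i`, the route is `Ω_{is}`, then `ℙ_{is}` by domestic trade,
then `W_j`. So a finite cost in either direction suffices. -/
theorem reflTransGen_dependsOn (hS : 0 < S) (hconn : M.TradeConnected) (v v' : Var J S) :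
    Relation.ReflTransGen M.DependsOn v v' := by
  have : NeZero S := ⟨hS.ne'⟩
  have partner (i j) (h : M.TradePartners i j) :
      Relation.ReflTransGen M.DependsOn (iW i) (iW j) := by
    obtain ⟨s, h | h⟩ := h
    · exact .head (.iW_iΩ i s) (.single (.iΩ_iW h))
    · exact .head (.iW_iΩ i s) (.head (.iΩ_iP (M.τ_self i s)) (.single (.iP_iW h)))
  have wages (i j) : Relation.ReflTransGen M.DependsOn (iW i) (iW j) := by
    induction hconn i j with
    | refl => exact .refl
    | tail _ h ih => exact ih.trans (partner _ _ h)
  have out (v) : ∃ i, Relation.ReflTransGen M.DependsOn v (iW i) := by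
    rcases v with ⟨i, s⟩ | ⟨i, s⟩ | i
    · exact ⟨i, .single (.iΩ_iW (M.τ_self i s))⟩
    · exact ⟨i, .single (.iP_iW (M.τ_self i s))⟩
    · exact ⟨i, .refl⟩
  have into (v) : ∃ i, Relation.ReflTransGen M.DependsOn (iW i) v := by
    rcases v with ⟨i, s⟩ | ⟨i, s⟩ | i
    · exact ⟨i, .single (.iW_iΩ i s)⟩
    · exact ⟨i, .head (.iW_iΩ i s) (.single (.iΩ_iP (M.τ_self i s)))⟩
    · exact ⟨i, .refl⟩
  obtain ⟨i, hi⟩ := out v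
  obtain ⟨j, hj⟩ := into v'
  exact hi.trans ((wages i j).trans hj)

end TradeModel

/-! ### Openness of the orthant, and irreducibility from a connected relation -/

theorem isOpen_posOrthant (V : Type*) [Finite V] : IsOpen (posOrthant V) := by
  simp only [posOrthant, Set.ofPred_forall]
  exact isOpen_iInter_of_finite fun v => isOpen_lt continuous_const (continuous_apply v)

/-- A matrix whose entrywise modulus is non-zero along a strongly connected relation with a loop
is irreducible. -/
theorem Matrix.isIrreducible_abs_of_reflTransGen {V : Type*} {A : Matrix V V ℝ} {E : V → V → Prop}
    (hE : ∀ v v', E v v' → A v v' ≠ 0) (hconn : ∀ v v', Relation.ReflTransGen E v v')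
    {a : V} (ha : E a a) : (A.map fun a => |a|).IsIrreducible := by
  refine ⟨fun i j => abs_nonneg _, ?_⟩
  let : Quiver V := Matrix.toQuiver (A.map fun a => |a|)
  have edge : ∀ {v v'}, E v v' → Nonempty (v ⟶ v') := fun h => ⟨⟨abs_pos.2 (hE _ _ h)⟩⟩
  have hsc : Quiver.IsStronglyConnected V := by
    intro i j
    induction hconn i j with
    | refl => exact ⟨.nil⟩
    | tail _ h ih =>
      obtain ⟨p⟩ := ih
      obtain ⟨e⟩ := edge h
      exact ⟨p.cons e⟩
  -- Irreducibility asks for paths of positive length; one existing edge upgrades strong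
  -- connectedness to that.
  obtain ⟨e⟩ := edge ha
  exact hsc.isSStronglyConnected_of_hom e

namespace TradeModel

variable {J S : ℕ} (M : TradeModel J S)

/-! ### The Jacobian matrix -/

theorem contDiffOn_rhs : ContDiffOn ℝ 1 M.rhs (posOrthant (Var J S)) := by
  have hpow (v : Var J S) (a : ℝ) :
      ContDiffOn ℝ 1 (fun x : Var J S → ℝ => x v ^ a) (posOrthant (Var J S)) :=
    (contDiff_apply ℝ ℝ v).contDiffOn.rpow_const_of_ne fun x hx => (hx v).ne'
  rw [contDiffOn_pi]
  rintro (⟨i, s⟩ | ⟨i, s⟩ | i)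
  · exact (ContDiffOn.sum fun j _ => contDiffOn_const.mul
      (((contDiff_apply ℝ ℝ (iP j s)).contDiffOn.inv fun x hx => (hx _).ne').mul
        (hpow (iW j) _))).congr fun x _ => M.rhs_iΩ x i s
  · exact (ContDiffOn.sum fun j _ => contDiffOn_const.mul (hpow (iW j) _)).congr
      fun x _ => M.rhs_iP x i s
  · exact (ContDiffOn.sum fun r _ => contDiffOn_const.mul
      ((contDiff_apply ℝ ℝ (iΩ i r)).contDiffOn.mul (hpow (iW i) _))).congr
      fun x _ => M.rhs_iW x i

/-- The derivative of the system at `x` in direction `d`. -/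
noncomputable def rhsDeriv (x d : Var J S → ℝ) : Var J S → ℝ :=
  stack
    (fun i s => ∑ j, M.demandCoeff i j s *
      (-d (iP j s) / x (iP j s) ^ 2 * x (iW j) ^ (1 / (1 + M.Θ)) +
        (x (iP j s))⁻¹ * (d (iW j) * (1 / (1 + M.Θ)) * x (iW j) ^ (1 / (1 + M.Θ) - 1))))
    (fun i s => ∑ j, M.coeff j i s *
      (d (iW j) * (-M.θ s / (1 + M.Θ)) * x (iW j) ^ (-M.θ s / (1 + M.Θ) - 1)))
    (fun i => ∑ r, (M.L i)⁻¹ * (d (iΩ i r) * x (iW i) ^ ((M.Θ - M.θ r) / (1 + M.Θ)) +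
      x (iΩ i r) * (d (iW i) * ((M.Θ - M.θ r) / (1 + M.Θ)) *
        x (iW i) ^ ((M.Θ - M.θ r) / (1 + M.Θ) - 1))))

theorem hasDerivAt_rhs {x : Var J S → ℝ} (hx : x ∈ posOrthant (Var J S)) (d : Var J S → ℝ)
    (v : Var J S) : HasDerivAt (fun t : ℝ => M.rhs (x + t • d) v) (M.rhsDeriv x d v) 0 := by
  have hlin (v) : HasDerivAt (fun t : ℝ => (x + t • d) v) (d v) 0 := by
    simpa using ((hasDerivAt_id (0 : ℝ)).mul_const (d v)).const_add (x v)
  have h0 (v) : (x + (0 : ℝ) • d) v = x v := by simp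
  have hne (v) : (x + (0 : ℝ) • d) v ≠ 0 := h0 v ▸ (hx v).ne'
  have hpow (v) (a : ℝ) := (hlin v).rpow_const (p := a) (Or.inl (hne v))
  have hinv (v) := (hlin v).fun_inv (hne v)
  simp only [h0] at hpow hinv
  rcases v with ⟨i, s⟩ | ⟨i, s⟩ | i
  · have := HasDerivAt.fun_sum (u := Finset.univ) fun j (_ : j ∈ Finset.univ) =>
      ((hinv (iP j s)).fun_mul (hpow (iW j) (1 / (1 + M.Θ)))).const_mul (M.demandCoeff i j s)
    simp only [h0] at this
    exact this.congr_of_eventuallyEq (.of_forall fun t => M.rhs_iΩ _ i s)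
  · exact (HasDerivAt.fun_sum (u := Finset.univ) fun j (_ : j ∈ Finset.univ) =>
      (hpow (iW j) (-M.θ s / (1 + M.Θ))).const_mul (M.coeff j i s)).congr_of_eventuallyEq
        (.of_forall fun t => M.rhs_iP _ i s)
  · have := HasDerivAt.fun_sum (u := Finset.univ) fun r (_ : r ∈ Finset.univ) =>
      ((hlin (iΩ i r)).fun_mul (hpow (iW i) ((M.Θ - M.θ r) / (1 + M.Θ)))).const_mul (M.L i)⁻¹
    simp only [h0] at this
    exact this.congr_of_eventuallyEq (.of_forall fun t => M.rhs_iW _ i)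

/-- Restrict the system to the line through `x` in a coordinate direction and use uniqueness of the
one-variable derivative. -/
theorem jacobian_rhs {x : Var J S → ℝ} (hx : x ∈ posOrthant (Var J S)) (v v' : Var J S) :
    jacobian M.rhs x v v' = M.rhsDeriv x (Pi.single v' 1) v := by
  have hdiff : DifferentiableAt ℝ M.rhs x :=
    (M.contDiffOn_rhs.contDiffAt ((isOpen_posOrthant _).mem_nhds hx)).differentiableAt (by simp)
  have hline : HasDerivAt (fun t : ℝ => x + t • (Pi.single v' 1 : Var J S → ℝ))
      (Pi.single v' 1) 0 := by
    simpa using ((hasDerivAt_id (0 : ℝ)).smul_const (Pi.single v' 1 : Var J S → ℝ)).const_add x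
  have hd : HasFDerivAt M.rhs (fderiv ℝ M.rhs x)
      (x + (0 : ℝ) • (Pi.single v' 1 : Var J S → ℝ)) := by
    simpa using hdiff.hasFDerivAt
  have h1 := hasDerivAt_pi.1 (hd.comp_hasDerivAt 0 hline) v
  exact h1.unique (M.hasDerivAt_rhs hx _ v)

theorem jacobian_rhs_ne_zero (hS : 2 ≤ S) {x : Var J S → ℝ} (hx : x ∈ posOrthant (Var J S))
    {v v' : Var J S} (h : M.DependsOn v v') : jacobian M.rhs x v v' ≠ 0 := by
  have hΘ := M.one_add_Θ_pos
  have hpow (v) (a : ℝ) : 0 < x v ^ a := Real.rpow_pos_of_pos (hx v) a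
  have hθ := M.θ_pos
  have hθΘ (r) : 0 < M.Θ - M.θ r := sub_pos.2 (M.θ_lt_Θ hS r)
  rw [M.jacobian_rhs hx]
  cases h with
  | iΩ_iP h =>
    simp [rhsDeriv, stack, Pi.single_apply, ite_div, neg_div, (M.demandCoeff_pos h).ne',
      (hx _).ne', (hpow _ _).ne']
  | iΩ_iW h =>
    simp [rhsDeriv, stack, Pi.single_apply, (M.demandCoeff_pos h).ne', (hx _).ne', hΘ.ne',
      (hpow _ _).ne']
  | iP_iW h =>
    simp [rhsDeriv, stack, Pi.single_apply, (M.coeff_pos h).ne', (hθ _).ne', hΘ.ne',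
      (hpow _ _).ne']
  | iW_iΩ i r => simp [rhsDeriv, stack, Pi.single_apply, (M.L_pos i).ne', (hpow _ _).ne']
  | iW_iW i =>
    have : NeZero S := ⟨by omega⟩
    -- Every sector contributes to this diagonal entry; all contributions are positive, so they
    -- cannot cancel.
    simp only [rhsDeriv, stack, Sum.elim_inr, Pi.single_eq_same, ne_eq, reduceCtorEq,
      not_false_eq_true, Pi.single_eq_of_ne, zero_mul, zero_add, one_mul]
    exact (Finset.sum_pos (fun r _ => mul_pos (inv_pos.2 (M.L_pos i)) (mul_pos (hx _)
      (mul_pos (div_pos (hθΘ r) hΘ) (hpow _ _)))) Finset.univ_nonempty).ne'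

/-- The entries of the system other than the price indices. -/
def nonPrice : Set (Var J S) :=
  {v | Sum.elim (fun _ => True) (Sum.elim (fun _ => False) fun _ => True) v}

theorem jacobian_rhs_sign (hS : 2 ≤ S) {x : Var J S → ℝ} (hx : x ∈ posOrthant (Var J S))
    (v v' : Var J S) :
    ((v ∈ nonPrice ↔ v' ∈ nonPrice) → 0 ≤ jacobian M.rhs x v v') ∧
      (¬ (v ∈ nonPrice ↔ v' ∈ nonPrice) → jacobian M.rhs x v v' ≤ 0) := by
  have hΘ := M.one_add_Θ_pos
  have hpow (v) (a : ℝ) : 0 < x v ^ a := Real.rpow_pos_of_pos (hx v) a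
  have hθ := M.θ_pos
  have hθΘ (r) : 0 < M.Θ - M.θ r := sub_pos.2 (M.θ_lt_Θ hS r)
  rw [M.jacobian_rhs hx]
  -- Of the nine blocks, four vanish identically and are closed by `simp`; the five left are
  -- `Ω`-`ℙ`, `Ω`-`W`, `ℙ`-`W`, `W`-`Ω` and `W`-`W`.
  rcases v with ⟨i, s⟩ | ⟨i, s⟩ | i <;> rcases v' with ⟨j, r⟩ | ⟨j, r⟩ | j <;>
    simp [rhsDeriv, stack, Pi.single_apply, ite_div, neg_div, nonPrice]
  · refine Finset.sum_nonneg fun j _ => ?_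
    split_ifs
    · exact mul_nonneg (M.demandCoeff_nonneg i j s)
        (mul_pos (inv_pos.2 (pow_pos (hx _) 2)) (hpow _ _)).le
    · exact le_rfl
  · exact mul_nonneg (M.demandCoeff_nonneg i j s) (mul_pos (inv_pos.2 (hx _))
      (mul_pos (inv_pos.2 hΘ) (hpow _ _))).le
  · exact mul_nonneg (M.coeff_nonneg j i s) (mul_pos (div_pos (hθ s) hΘ) (hpow _ _)).le
  · refine Finset.sum_nonneg fun r _ => ?_
    split_ifs
    · exact (mul_pos (inv_pos.2 (M.L_pos i)) (hpow _ _)).le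
    · exact le_rfl
  · split_ifs
    · exact Finset.sum_nonneg fun r _ => (mul_pos (inv_pos.2 (M.L_pos i)) (mul_pos (hx _)
        (mul_pos (div_pos (hθΘ r) hΘ) (hpow _ _)))).le
    · exact le_rfl

theorem monotonicityConsistentWith_rhs (hS : 2 ≤ S) (k : ℝ) :
    MonotonicityConsistentWith M.rhs (M.scalingExponent k) := by
  have hΘ := M.one_add_Θ_pos
  have hsign (v : Var J S) : (v ∈ nonPrice → 0 ≤ M.scalingExponent 1 v) ∧
      (v ∉ nonPrice → M.scalingExponent 1 v ≤ 0) := by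
    rcases v with ⟨i, s⟩ | ⟨i, s⟩ | i
    · have := M.θ_pos s
      simp only [nonPrice, scalingExponent_iΩ]
      simp
      positivity
    · have := M.θ_pos s
      simp only [nonPrice, scalingExponent_iP]
      simp
      positivity
    · simp [nonPrice, scalingExponent_iW]
  rcases le_total 0 k with hk | hk
  · refine ⟨nonPrice, fun v hv => ?_, fun v hv => ?_, fun x hx => M.jacobian_rhs_sign hS hx⟩
    · rw [scalingExponent_eq_mul]
      exact mul_nonneg ((hsign v).1 hv) hk
    · rw [scalingExponent_eq_mul]
      exact mul_nonpos_of_nonpos_of_nonneg ((hsign v).2 hv) hk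
  -- A negative `k` reverses all signs of `u`, and the Jacobian condition is invariant under
  -- exchanging the two classes.
  · refine ⟨nonPriceᶜ, fun v hv => ?_, fun v hv => ?_, fun x hx v v' => ?_⟩
    · rw [scalingExponent_eq_mul]
      exact mul_nonneg_of_nonpos_of_nonpos ((hsign v).2 hv) hk
    · rw [scalingExponent_eq_mul]
      exact mul_nonpos_of_nonneg_of_nonpos ((hsign v).1 (not_not.1 hv)) hk
    · simpa only [Set.mem_compl_iff, not_iff_not] using M.jacobian_rhs_sign hS hx v v'

end TradeModel

namespace TradeModel

variable {J S : ℕ} (M : TradeModel J S)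

/-! ### Logarithmic coordinates -/

/-- The positive vector with logarithmic coordinates `t`, relative to the scaling exponent. -/
noncomputable def ofLogCoords (t : Var J S → ℝ) : Var J S → ℝ :=
  fun v => Real.exp (M.scalingExponent 1 v * t v)

/-- Logarithmic coordinates of a positive vector, relative to the scaling exponent. -/
noncomputable def logCoords (x : Var J S → ℝ) : Var J S → ℝ :=
  fun v => Real.log (x v) / M.scalingExponent 1 v

/-- The system in logarithmic coordinates. -/
noncomputable def logRhs (t : Var J S → ℝ) : Var J S → ℝ :=
  M.logCoords (M.rhs (M.ofLogCoords t))

theorem ofLogCoords_mem (t : Var J S → ℝ) : M.ofLogCoords t ∈ posOrthant (Var J S) :=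
  fun _ => Real.exp_pos _

theorem ofLogCoords_logCoords {x : Var J S → ℝ} (hx : x ∈ posOrthant (Var J S)) :
    M.ofLogCoords (M.logCoords x) = x := by
  funext v
  rw [ofLogCoords, logCoords, mul_div_cancel₀ _ (M.scalingExponent_ne_zero one_ne_zero v),
    Real.exp_log (hx v)]

theorem logCoords_ofLogCoords (t : Var J S → ℝ) : M.logCoords (M.ofLogCoords t) = t := by
  funext v
  rw [logCoords, ofLogCoords, Real.log_exp,
    mul_div_cancel_left₀ _ (M.scalingExponent_ne_zero one_ne_zero v)]

theorem continuous_ofLogCoords : Continuous (M.ofLogCoords : (Var J S → ℝ) → _) := by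
  unfold ofLogCoords
  fun_prop

theorem continuousAt_logCoords {x : Var J S → ℝ} (hx : x ∈ posOrthant (Var J S)) :
    ContinuousAt M.logCoords x :=
  continuousAt_pi.2 fun v =>
    ContinuousAt.div_const (ContinuousAt.log (f := fun y : Var J S → ℝ => y v)
      (continuous_apply v).continuousAt (hx v).ne') _

theorem ofLogCoords_add_const (t : Var J S → ℝ) (c : ℝ) :
    M.ofLogCoords (fun v => t v + c) =
      scaleBy (Real.exp c) (M.scalingExponent 1) (M.ofLogCoords t) := by
  funext v
  rw [ofLogCoords, scaleBy, ofLogCoords, ← Real.exp_mul, ← Real.exp_add]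
  congr 1
  ring

theorem ofLogCoords_logRhs (hS : 0 < S) (t : Var J S → ℝ) :
    M.ofLogCoords (M.logRhs t) = M.rhs (M.ofLogCoords t) :=
  M.ofLogCoords_logCoords (M.mapsTo_rhs hS (M.ofLogCoords_mem t))

theorem ofLogCoords_iterate_logRhs (hS : 0 < S) (n : ℕ) (t : Var J S → ℝ) :
    M.ofLogCoords (M.logRhs^[n] t) = M.rhs^[n] (M.ofLogCoords t) :=
  Function.Semiconj.iterate_right (M.ofLogCoords_logRhs hS) n t

theorem iterate_rhs_eq (hS : 0 < S) {x : Var J S → ℝ} (hx : x ∈ posOrthant (Var J S)) (n : ℕ) :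
    M.rhs^[n] x = M.ofLogCoords (M.logRhs^[n] (M.logCoords x)) := by
  rw [M.ofLogCoords_iterate_logRhs hS, M.ofLogCoords_logCoords hx]

/-- Translation by `c` in these coordinates is scaling by `exp c` with exponent `u(1)`, and that
commutes with the system. -/
theorem logRhs_add_const (hS : 0 < S) (t : Var J S → ℝ) (c : ℝ) :
    M.logRhs (fun v => t v + c) = fun v => M.logRhs t v + c := by
  rw [← M.logCoords_ofLogCoords fun v => M.logRhs t v + c, ofLogCoords_add_const,
    M.ofLogCoords_logRhs hS, logRhs, ofLogCoords_add_const,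
    M.scalesWithExponent_rhs 1 _ (M.ofLogCoords_mem t) _ (Real.exp_pos c)]

/-! ### Order in logarithmic coordinates, reversed at price entries -/

section Monotone

variable {M}

theorem ofLogCoords_le_iff {t t' : Var J S → ℝ} {v : Var J S} (hv : 0 < M.scalingExponent 1 v) :
    M.ofLogCoords t v ≤ M.ofLogCoords t' v ↔ t v ≤ t' v := by
  rw [ofLogCoords, ofLogCoords, Real.exp_le_exp, mul_le_mul_iff_right₀ hv]

theorem ofLogCoords_lt_iff {t t' : Var J S → ℝ} {v : Var J S} (hv : 0 < M.scalingExponent 1 v) :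
    M.ofLogCoords t v < M.ofLogCoords t' v ↔ t v < t' v := by
  rw [ofLogCoords, ofLogCoords, Real.exp_lt_exp, mul_lt_mul_iff_right₀ hv]

theorem ofLogCoords_le_iff_of_neg {t t' : Var J S → ℝ} {v : Var J S}
    (hv : M.scalingExponent 1 v < 0) :
    M.ofLogCoords t v ≤ M.ofLogCoords t' v ↔ t' v ≤ t v := by
  rw [ofLogCoords, ofLogCoords, Real.exp_le_exp, mul_le_mul_left_of_neg hv]

theorem ofLogCoords_lt_iff_of_neg {t t' : Var J S → ℝ} {v : Var J S}
    (hv : M.scalingExponent 1 v < 0) :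
    M.ofLogCoords t v < M.ofLogCoords t' v ↔ t' v < t v := by
  rw [ofLogCoords, ofLogCoords, Real.exp_lt_exp, mul_lt_mul_left_of_neg hv]

end Monotone

theorem scalingExponent_iΩ_pos (i : Fin J) (s : Fin S) : 0 < M.scalingExponent 1 (iΩ i s) := by
  have := M.θ_pos s
  have := M.one_add_Θ_pos
  rw [scalingExponent_iΩ]
  positivity

theorem scalingExponent_iP_neg (i : Fin J) (s : Fin S) : M.scalingExponent 1 (iP i s) < 0 := by
  have := div_pos (M.θ_pos s) M.one_add_Θ_pos
  rw [scalingExponent_iP]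
  linarith

theorem scalingExponent_iW_pos (i : Fin J) : 0 < M.scalingExponent 1 (iW i : Var J S) :=
  zero_lt_one

/-! ### Monotonicity of the individual summands and of the whole system -/

theorem demand_term_le {t t' : Var J S → ℝ} (h : t ≤ t') (j : Fin J) (s : Fin S) :
    (M.ofLogCoords t (iP j s))⁻¹ * M.ofLogCoords t (iW j) ^ (1 / (1 + M.Θ)) ≤
      (M.ofLogCoords t' (iP j s))⁻¹ * M.ofLogCoords t' (iW j) ^ (1 / (1 + M.Θ)) :=
  mul_le_mul
    (inv_anti₀ (M.ofLogCoords_mem t' _)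
      ((ofLogCoords_le_iff_of_neg (M.scalingExponent_iP_neg j s)).2 (h _)))
    (Real.rpow_le_rpow (M.ofLogCoords_mem t _).le
      ((ofLogCoords_le_iff (M.scalingExponent_iW_pos j)).2 (h _))
      (div_pos one_pos M.one_add_Θ_pos).le)
    (Real.rpow_pos_of_pos (M.ofLogCoords_mem t _) _).le (inv_pos.2 (M.ofLogCoords_mem t' _)).le

theorem demand_term_lt {t t' : Var J S → ℝ} (h : t ≤ t') {j : Fin J} {s : Fin S}
    (hlt : t (iP j s) < t' (iP j s) ∨ t (iW j) < t' (iW j)) :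
    (M.ofLogCoords t (iP j s))⁻¹ * M.ofLogCoords t (iW j) ^ (1 / (1 + M.Θ)) <
      (M.ofLogCoords t' (iP j s))⁻¹ * M.ofLogCoords t' (iW j) ^ (1 / (1 + M.Θ)) := by
  have hpos := div_pos one_pos M.one_add_Θ_pos
  rcases hlt with hlt | hlt
  · exact mul_lt_mul
      (inv_strictAnti₀ (M.ofLogCoords_mem t' _)
        ((ofLogCoords_lt_iff_of_neg (M.scalingExponent_iP_neg j s)).2 hlt))
      (Real.rpow_le_rpow (M.ofLogCoords_mem t _).le
        ((ofLogCoords_le_iff (M.scalingExponent_iW_pos j)).2 (h _)) hpos.le)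
      (Real.rpow_pos_of_pos (M.ofLogCoords_mem t _) _) (inv_pos.2 (M.ofLogCoords_mem t' _)).le
  · exact mul_lt_mul'
      (inv_anti₀ (M.ofLogCoords_mem t' _)
        ((ofLogCoords_le_iff_of_neg (M.scalingExponent_iP_neg j s)).2 (h _)))
      (Real.rpow_lt_rpow (M.ofLogCoords_mem t _).le
        ((ofLogCoords_lt_iff (M.scalingExponent_iW_pos j)).2 hlt) hpos)
      (Real.rpow_pos_of_pos (M.ofLogCoords_mem t _) _).le (inv_pos.2 (M.ofLogCoords_mem t' _))

theorem supply_term_le {t t' : Var J S → ℝ} (h : t ≤ t') (j : Fin J) (s : Fin S) :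
    M.ofLogCoords t' (iW j) ^ (-M.θ s / (1 + M.Θ)) ≤
      M.ofLogCoords t (iW j) ^ (-M.θ s / (1 + M.Θ)) :=
  Real.rpow_le_rpow_of_nonpos (M.ofLogCoords_mem t _)
    ((ofLogCoords_le_iff (M.scalingExponent_iW_pos j)).2 (h _))
    (div_neg_of_neg_of_pos (neg_neg_iff_pos.2 (M.θ_pos s)) M.one_add_Θ_pos).le

theorem supply_term_lt {t t' : Var J S → ℝ} {j : Fin J} (s : Fin S)
    (hlt : t (iW j) < t' (iW j)) :
    M.ofLogCoords t' (iW j) ^ (-M.θ s / (1 + M.Θ)) <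
      M.ofLogCoords t (iW j) ^ (-M.θ s / (1 + M.Θ)) :=
  Real.rpow_lt_rpow_of_neg (M.ofLogCoords_mem t _)
    ((ofLogCoords_lt_iff (M.scalingExponent_iW_pos j)).2 hlt)
    (div_neg_of_neg_of_pos (neg_neg_iff_pos.2 (M.θ_pos s)) M.one_add_Θ_pos)

theorem wage_term_le (hS : 2 ≤ S) {t t' : Var J S → ℝ} (h : t ≤ t') (i : Fin J) (r : Fin S) :
    M.ofLogCoords t (iΩ i r) * M.ofLogCoords t (iW i) ^ ((M.Θ - M.θ r) / (1 + M.Θ)) ≤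
      M.ofLogCoords t' (iΩ i r) * M.ofLogCoords t' (iW i) ^ ((M.Θ - M.θ r) / (1 + M.Θ)) :=
  mul_le_mul ((ofLogCoords_le_iff (M.scalingExponent_iΩ_pos i r)).2 (h _))
    (Real.rpow_le_rpow (M.ofLogCoords_mem t _).le
      ((ofLogCoords_le_iff (M.scalingExponent_iW_pos i)).2 (h _))
      (div_pos (sub_pos.2 (M.θ_lt_Θ hS r)) M.one_add_Θ_pos).le)
    (Real.rpow_pos_of_pos (M.ofLogCoords_mem t _) _).le (M.ofLogCoords_mem t' _).le

theorem wage_term_lt (hS : 2 ≤ S) {t t' : Var J S → ℝ} (h : t ≤ t') {i : Fin J} {r : Fin S}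
    (hlt : t (iΩ i r) < t' (iΩ i r) ∨ t (iW i) < t' (iW i)) :
    M.ofLogCoords t (iΩ i r) * M.ofLogCoords t (iW i) ^ ((M.Θ - M.θ r) / (1 + M.Θ)) <
      M.ofLogCoords t' (iΩ i r) * M.ofLogCoords t' (iW i) ^ ((M.Θ - M.θ r) / (1 + M.Θ)) := by
  have hpos := div_pos (sub_pos.2 (M.θ_lt_Θ hS r)) M.one_add_Θ_pos
  rcases hlt with hlt | hlt
  · exact mul_lt_mul ((ofLogCoords_lt_iff (M.scalingExponent_iΩ_pos i r)).2 hlt)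
      (Real.rpow_le_rpow (M.ofLogCoords_mem t _).le
        ((ofLogCoords_le_iff (M.scalingExponent_iW_pos i)).2 (h _)) hpos.le)
      (Real.rpow_pos_of_pos (M.ofLogCoords_mem t _) _) (M.ofLogCoords_mem t' _).le
  · exact mul_lt_mul' ((ofLogCoords_le_iff (M.scalingExponent_iΩ_pos i r)).2 (h _))
      (Real.rpow_lt_rpow (M.ofLogCoords_mem t _).le
        ((ofLogCoords_lt_iff (M.scalingExponent_iW_pos i)).2 hlt) hpos)
      (Real.rpow_pos_of_pos (M.ofLogCoords_mem t _) _).le (M.ofLogCoords_mem t' _)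

/-- At the price entries the supply sum falls as wages rise, but the coordinate also reverses order
there, so the two reversals cancel. -/
theorem monotone_logRhs (hS : 2 ≤ S) : Monotone (M.logRhs : (Var J S → ℝ) → _) := by
  intro t t' h v
  have hmem := M.ofLogCoords_logRhs (S := S) (by omega)
  rcases v with ⟨i, s⟩ | ⟨i, s⟩ | i
  · refine (ofLogCoords_le_iff (M.scalingExponent_iΩ_pos i s)).1 ?_
    rw [hmem, hmem, rhs_iΩ, rhs_iΩ]
    exact Finset.sum_le_sum fun j _ => mul_le_mul_of_nonneg_left (M.demand_term_le h j s)
      (M.demandCoeff_nonneg i j s)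
  · refine (ofLogCoords_le_iff_of_neg (M.scalingExponent_iP_neg i s)).1 ?_
    rw [hmem, hmem, rhs_iP, rhs_iP]
    exact Finset.sum_le_sum fun j _ => mul_le_mul_of_nonneg_left (M.supply_term_le h j s)
      (M.coeff_nonneg j i s)
  · refine (ofLogCoords_le_iff (M.scalingExponent_iW_pos i)).1 ?_
    rw [hmem, hmem, rhs_iW, rhs_iW]
    exact Finset.sum_le_sum fun r _ => mul_le_mul_of_nonneg_left (M.wage_term_le hS h i r)
      (inv_pos.2 (M.L_pos i)).le

theorem logRhs_lt (hS : 2 ≤ S) (t t' : Var J S → ℝ) (v v' : Var J S) (h : t ≤ t')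
    (hdep : M.DependsOn v v') (hlt : t v' < t' v') : M.logRhs t v < M.logRhs t' v := by
  have hmem := M.ofLogCoords_logRhs (S := S) (by omega)
  have demand {i j s} (hτ : M.τ i j s ≠ ⊤)
      (hlt : t (iP j s) < t' (iP j s) ∨ t (iW j) < t' (iW j)) :
      M.logRhs t (iΩ i s) < M.logRhs t' (iΩ i s) := by
    refine (ofLogCoords_lt_iff (M.scalingExponent_iΩ_pos i s)).1 ?_
    rw [hmem, hmem, rhs_iΩ, rhs_iΩ]
    exact Finset.sum_lt_sum (fun j _ => mul_le_mul_of_nonneg_left (M.demand_term_le h j s)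
      (M.demandCoeff_nonneg i j s)) ⟨j, Finset.mem_univ j,
        mul_lt_mul_of_pos_left (M.demand_term_lt h hlt) (M.demandCoeff_pos hτ)⟩
  have wage {i} (r : Fin S) (hlt : t (iΩ i r) < t' (iΩ i r) ∨ t (iW i) < t' (iW i)) :
      M.logRhs t (iW i) < M.logRhs t' (iW i) := by
    refine (ofLogCoords_lt_iff (M.scalingExponent_iW_pos i)).1 ?_
    rw [hmem, hmem, rhs_iW, rhs_iW]
    exact Finset.sum_lt_sum (fun r _ => mul_le_mul_of_nonneg_left (M.wage_term_le hS h i r)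
      (inv_pos.2 (M.L_pos i)).le) ⟨r, Finset.mem_univ r,
        mul_lt_mul_of_pos_left (M.wage_term_lt hS h hlt) (inv_pos.2 (M.L_pos i))⟩
  cases hdep with
  | iΩ_iP hτ => exact demand hτ (.inl hlt)
  | iΩ_iW hτ => exact demand hτ (.inr hlt)
  | @iP_iW i j s hτ =>
    refine (ofLogCoords_lt_iff_of_neg (M.scalingExponent_iP_neg i s)).1 ?_
    rw [hmem, hmem, rhs_iP, rhs_iP]
    exact Finset.sum_lt_sum (fun j _ => mul_le_mul_of_nonneg_left (M.supply_term_le h j s)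
      (M.coeff_nonneg j i s)) ⟨j, Finset.mem_univ j,
        mul_lt_mul_of_pos_left (M.supply_term_lt s hlt) (M.coeff_pos hτ)⟩
  | iW_iΩ i r => exact wage r (.inl hlt)
  -- `W_i` occurs in the summand of every sector, so any sector serves as the strict one.
  | iW_iW i => exact wage ⟨0, by omega⟩ (.inr hlt)

/-! ### Fixed points and convergence -/

theorem logRhs_logCoords {x : Var J S → ℝ} (hx : IsPosFixedPoint M.rhs x) :
    M.logRhs (M.logCoords x) = M.logCoords x := by
  rw [logRhs, M.ofLogCoords_logCoords hx.1, hx.2]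

theorem isPosFixedPoint_scaleBy {x : Var J S → ℝ} (hx : IsPosFixedPoint M.rhs x) {c : ℝ}
    (hc : 0 < c) (k : ℝ) : IsPosFixedPoint M.rhs (scaleBy c (M.scalingExponent k) x) :=
  ⟨fun v => mul_pos (Real.rpow_pos_of_pos hc _) (hx.1 v), by
    rw [M.scalesWithExponent_rhs k x hx.1 c hc, hx.2]⟩

theorem exists_tendsto_iterate_rhs (hJ : 1 ≤ J) (hS : 2 ≤ S) (hconn : M.TradeConnected)
    {xs : Var J S → ℝ} (hxs : IsPosFixedPoint M.rhs xs) {x : Var J S → ℝ}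
    (hx : x ∈ posOrthant (Var J S)) :
    ∃ c : ℝ, 0 < c ∧
      Tendsto (fun n => M.rhs^[n] x) atTop (𝓝 (scaleBy c (M.scalingExponent 1) xs)) := by
  have hS0 : 0 < S := by omega
  let a : Var J S := iW ⟨0, hJ⟩
  have : Nonempty (Var J S) := ⟨a⟩
  obtain ⟨c, hc⟩ := AdditivelyHomogeneous.exists_tendsto_iterate (M.monotone_logRhs hS)
    (M.logRhs_add_const hS0)
    (fun t t' hle hne => AdditivelyHomogeneous.exists_iterate_lt (M.monotone_logRhs hS)
      (M.logRhs_lt hS) (M.reflTransGen_dependsOn hS0 hconn) (a := a) (.iW_iW _) hle hne)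
    (M.logRhs_logCoords hxs) (M.logCoords x)
  refine ⟨Real.exp c, Real.exp_pos c, ?_⟩
  have := (M.continuous_ofLogCoords.tendsto _).comp hc
  rw [ofLogCoords_add_const, M.ofLogCoords_logCoords hxs.1] at this
  exact this.congr fun n => (M.iterate_rhs_eq hS0 hx n).symm

theorem isPosFixedPoint_iff (hJ : 1 ≤ J) (hS : 2 ≤ S) (hconn : M.TradeConnected)
    {xs : Var J S → ℝ} (hxs : IsPosFixedPoint M.rhs xs) {k : ℝ} (hk : k ≠ 0)
    (y : Var J S → ℝ) : IsPosFixedPoint M.rhs y ↔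
      ∃ c : ℝ, 0 < c ∧ y = scaleBy c (M.scalingExponent k) xs := by
  constructor
  · intro hy
    obtain ⟨c, hc, hlim⟩ := M.exists_tendsto_iterate_rhs hJ hS hconn hxs hy.1
    simp only [Function.iterate_fixed hy.2] at hlim
    -- Since `u(k) = k u(1)`, the factor `c` for exponent `u(1)` becomes `c ^ (1 / k)` for `u(k)`.
    refine ⟨c ^ k⁻¹, Real.rpow_pos_of_pos hc _, ?_⟩
    rw [tendsto_nhds_unique tendsto_const_nhds hlim]
    funext v
    rw [scaleBy, scaleBy, ← Real.rpow_mul hc.le, M.scalingExponent_eq_mul k, mul_comm _ k,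
      inv_mul_cancel_left₀ hk]
  · rintro ⟨c, hc, rfl⟩
    exact M.isPosFixedPoint_scaleBy hxs hc k

/-- All iterates are nonexpansive in logarithmic coordinates. Continuity of the two coordinate
changes at `xs` and at its image then gives a `δ` that is uniform in `n`. -/
theorem isLyapunovStable_rhs (hS : 2 ≤ S) {xs : Var J S → ℝ} (hxs : IsPosFixedPoint M.rhs xs) :
    IsLyapunovStable M.rhs xs := by
  have hS0 : 0 < S := by omega
  intro ε hε
  obtain ⟨η, hη, hηε⟩ := Metric.continuousAt_iff.1
    (M.continuous_ofLogCoords.continuousAt (x := M.logCoords xs)) ε hε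
  obtain ⟨δ, hδ, hδη⟩ := Metric.continuousAt_iff.1 (M.continuousAt_logCoords hxs.1) η hη
  refine ⟨δ, hδ, fun x hx hdist n => ?_⟩
  have hfix := Function.iterate_fixed (M.logRhs_logCoords hxs) n
  have hlip := (AdditivelyHomogeneous.lipschitzWith_one_iterate (M.monotone_logRhs hS)
    (M.logRhs_add_const hS0) n).dist_le_mul (M.logCoords x) (M.logCoords xs)
  rw [NNReal.coe_one, one_mul, hfix] at hlip
  rw [M.iterate_rhs_eq hS0 hx, M.iterate_rhs_eq hS0 hxs.1, hfix]
  exact hηε (hlip.trans_lt (hδη hdist))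

end TradeModel

theorem mainTheorem3 {J S : ℕ} (hJ : 1 ≤ J) (hS : 2 ≤ S) (M : TradeModel J S)
    (hconn : M.TradeConnected) :
    -- the fixed points of the system are the general equilibria of the model
    (∀ (w : Fin J → ℝ) (P R : Fin J → Fin S → ℝ), (∀ i, 0 < w i) → (∀ i s, 0 < P i s) →
      (∀ i s, 0 < R i s) →
      (M.IsGeneralEquilibrium w P R ↔ M.rhs (M.toVariables w P R) = M.toVariables w P R)) ∧
    -- the system satisfies the hypotheses of the fixed point theorem
    Set.MapsTo M.rhs (posOrthant (TradeModel.Var J S)) (posOrthant (TradeModel.Var J S)) ∧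
    ContDiffOn ℝ 1 M.rhs (posOrthant (TradeModel.Var J S)) ∧
    ConnectsAllVariables M.rhs ∧
    ExhibitsSelfInteraction M.rhs ∧
    (∀ k : ℝ, k ≠ 0 →
      (∃ v, M.scalingExponent k v ≠ 0) ∧
      ScalesWithExponent M.rhs (M.scalingExponent k) ∧
      MonotonicityConsistentWith M.rhs (M.scalingExponent k)) ∧
    -- uniqueness up to scale, stability and global convergence
    (∀ xs, IsPosFixedPoint M.rhs xs →
      (∀ k : ℝ, k ≠ 0 → ∀ y, IsPosFixedPoint M.rhs y ↔
        ∃ c : ℝ, 0 < c ∧ y = scaleBy c (M.scalingExponent k) xs) ∧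
      IsLyapunovStable M.rhs xs ∧
      (∀ x ∈ posOrthant (TradeModel.Var J S),
        ∃ y, IsPosFixedPoint M.rhs y ∧ Tendsto (fun n : ℕ => M.rhs^[n] x) atTop (𝓝 y))) := by
  have hS0 : 0 < S := by omega
  refine ⟨fun w P R hw hP hR => M.isGeneralEquilibrium_iff hw hP hR, M.mapsTo_rhs hS0,
    M.contDiffOn_rhs, fun x hx => ?_, fun x hx => ?_, fun k hk => ?_, fun xs hxs => ?_⟩
  · exact Matrix.isIrreducible_abs_of_reflTransGen (fun v v' h => M.jacobian_rhs_ne_zero hS hx h)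
      (M.reflTransGen_dependsOn hS0 hconn) (a := TradeModel.iW ⟨0, hJ⟩) (.iW_iW _)
  · exact ⟨TradeModel.iW ⟨0, hJ⟩, M.jacobian_rhs_ne_zero hS hx (.iW_iW _)⟩
  · exact ⟨⟨TradeModel.iW ⟨0, hJ⟩, M.scalingExponent_ne_zero hk _⟩, M.scalesWithExponent_rhs k,
      M.monotonicityConsistentWith_rhs hS k⟩
  · refine ⟨fun k hk y => M.isPosFixedPoint_iff hJ hS hconn hxs hk y,
      M.isLyapunovStable_rhs hS hxs, fun x hx => ?_⟩
    obtain ⟨c, hc, hlim⟩ := M.exists_tendsto_iterate_rhs hJ hS hconn hxs hx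
    exact ⟨_, M.isPosFixedPoint_scaleBy hxs hc 1, hlim⟩
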